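/- Let $k$ be a field and let $a\ge 11$, $d\ge 1$ be integers with $\gcd(a,d)=1$. Put $s_n=\frac n2\,(2a+(n-1)d)$ for $1\le n\le 5$, let $\Gamma_5=\langle s_1,\dots,s_5\rangle\subseteq\mathbb N$, and let $R=k[[\Gamma_5]]=k[[t^{s_1},\dots,t^{s_5}]]$ be the ring of power series in $k[[t]]$ whose exponents lie in $\Gamma_5$, a local ring with maximal ideal $\mathfrak m$. Let $G_{\mathfrak m}=\bigoplus_{n\ge 0}\mathfrak m^n/\mathfrak m^{n+1}$ be its tangent cone and $HG_{\mathfrak m}(x)=\sum_{n\ge 0}\dim_k(\mathfrak m^n/\mathfrak m^{n+1})\,x^n$ its Hilbert series. Define the order of an element of $\Gamma_5$ as the largest number of summands in an expression of it as a sum of generators $s_1,\dots,s_5$ (repetitions allowed), and let $t_j$ be the number of elements of order $j$ in the Apéry set $\mathrm{Ap}(\Gamma_5,a)=\{s\in\Gamma_5 : s-a\notin\Gamma_5\}$. Then all the spaces $\mathfrak m^n/\mathfrak m^{n+1}$ are finite-dimensional over $k$ and $$HG_{\mathfrak m}(x)=\frac{\sum_{j=0}^{\lfloor a/10\rfloor+2}t_j\,x^j}{1-x}.$$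 Moreover the $t_j$ are given as follows. Write $a=10q+r$ with $0\le r\le 9$, and put $\psi(2)=-1$, $\psi(3)=2$ and $\psi(j)=0$ for $j\ne 2,3$. Then $t_0=1$, $t_1=4$, and for $j\ge 2$: - if $j<q$: $t_j=10+\psi(j)$; - if $j=q$: $t_j=9+\psi(j)$ for $r=0$, and $t_j=10+\psi(j)$ for $r>0$; - if $j=q+1$: $t_j=c_r+\psi(j)$, where $c_r=5$ for $r\in\{0,1\}$, $c_2=6$, $c_3=7$, $c_r=8$ for $r\in\{4,5,6\}$, and $c_r=9$ for $r\in\{7,8,9\}$; - if $j=q+2$: $t_j=c'_r+\psi(j)$, where $c'_r=0$ for $0\le r\le 4$, $c'_5=1$, $c'_6=c'_7=2$, $c'_8=3$, $c'_9=4$; - if $j>q+2$: $t_j=0$. -/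

import Mathlib

open scoped PowerSeries

namespace TangentConeGamma5

/-- `s_n = (n / 2) (2 a + (n - 1) d)`, the sum of the first `n` terms of the arithmetic
progression `a, a + d, a + 2 d, …`. The natural number division is exact. -/
def gen (a d n : ℕ) : ℕ := n * (2 * a + (n - 1) * d) / 2

theorem gen_eq (a d : ℕ) :
    gen a d 1 = a ∧ gen a d 2 = 2 * a + d ∧ gen a d 3 = 3 * a + 3 * d ∧
      gen a d 4 = 4 * a + 6 * d ∧ gen a d 5 = 5 * a + 10 * d := by
  unfold gen
  refine ⟨?_, ?_, ?_, ?_, ?_⟩ <;> norm_num <;> omega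

/-- The numerical semigroup `Γ₅` generated by `s₁, …, s₅`. -/
def Gamma5 (a d : ℕ) : AddSubmonoid ℕ :=
  AddSubmonoid.closure {x | ∃ i : Fin 5, x = gen a d (i + 1)}

/-- The Apéry set `Ap(S, a)`: the `s ∈ S` such that the integer `s - a` is not in `S`. -/
def aperySet (S : AddSubmonoid ℕ) (a : ℕ) : Set ℕ :=
  {s | s ∈ S ∧ ¬ ∃ y ∈ S, s = y + a}

/-- The order of `x ∈ Γ₅`: the largest `n` such that `x` is a sum of `n` of the generators
`s₁, …, s₅` (repetitions allowed). -/
noncomputable def order (a d x : ℕ) : ℕ :=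
  sSup {n | ∃ c : Fin 5 → ℕ, ∑ i, c i * gen a d (i + 1) = x ∧ ∑ i, c i = n}

/-- `t_k`: the number of elements of order `k` in the Apéry set `Ap(Γ₅, a)`. -/
noncomputable def t (a d k : ℕ) : ℕ :=
  {x | x ∈ aperySet (Gamma5 a d) a ∧ order a d x = k}.ncard

/-- The correction `ψ` with `ψ(2) = -1`, `ψ(3) = 2` and `ψ(k) = 0` otherwise. -/
def psi (k : ℕ) : ℤ := if k = 2 then -1 else if k = 3 then 2 else 0

/-- The explicit table of values of `t_k`, for `a = 10 q + r` with `0 ≤ r ≤ 9`. -/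
def tTable (a k : ℕ) : ℤ :=
  let q := a / 10
  let r := a % 10
  if k = 0 then 1
  else if k = 1 then 4
  else if k < q then 10 + psi k
  else if k = q then (if r = 0 then 9 + psi k else 10 + psi k)
  else if k = q + 1 then
    (if r ≤ 1 then 5 + psi k
     else if r = 2 then 6 + psi k
     else if r = 3 then 7 + psi k
     else if r ≤ 6 then 8 + psi k
     else 9 + psi k)
  else if k = q + 2 then
    (if r ≤ 4 then psi k
     else if r = 5 then 1 + psi k
     else if r ≤ 7 then 2 + psi k
     else if r = 8 then 3 + psi k
     else 4 + psi k)
  else 0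

/-- The formal power series all of whose exponents lie in `S`, as a subalgebra of `k[[t]]`. -/
def powerSeriesWithExponentsIn (k : Type*) [Field k] (S : AddSubmonoid ℕ) : Subalgebra k k⟦X⟧ where
  carrier := {f | ∀ n, PowerSeries.coeff n f ≠ 0 → n ∈ S}
  mul_mem' := by
    intro f g hf hg n hn
    rw [PowerSeries.coeff_mul] at hn
    obtain ⟨p, hp, hne⟩ := Finset.exists_ne_zero_of_sum_ne_zero hn
    rw [← Finset.HasAntidiagonal.mem_antidiagonal.1 hp]
    exact S.add_mem (hf _ (left_ne_zero_of_mul hne)) (hg _ (right_ne_zero_of_mul hne))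
  add_mem' := by
    intro f g hf hg n hn
    by_cases h : PowerSeries.coeff n f = 0
    · exact hg n (by simpa [h] using hn)
    · exact hf n h
  algebraMap_mem' := by
    intro r n hn
    rw [PowerSeries.algebraMap_apply, PowerSeries.coeff_C] at hn
    by_cases h : n = 0
    · exact h ▸ S.zero_mem
    · simp [h] at hn

theorem inv_mem_powerSeriesWithExponentsIn {k : Type*} [Field k] {S : AddSubmonoid ℕ} {f : k⟦X⟧}
    (hf : f ∈ powerSeriesWithExponentsIn k S) : f⁻¹ ∈ powerSeriesWithExponentsIn k S := by
  intro n
  induction n using Nat.strong_induction_on with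
  | _ n ih =>
    intro hn
    rw [PowerSeries.coeff_inv] at hn
    by_cases h0 : n = 0
    · exact h0 ▸ S.zero_mem
    rw [if_neg h0] at hn
    obtain ⟨p, hp, hne⟩ := Finset.exists_ne_zero_of_sum_ne_zero (right_ne_zero_of_mul hn)
    by_cases hlt : p.2 < n
    · rw [if_pos hlt] at hne
      rw [← Finset.HasAntidiagonal.mem_antidiagonal.1 hp]
      exact S.add_mem (hf _ (left_ne_zero_of_mul hne)) (ih _ hlt (right_ne_zero_of_mul hne))
    · simp [hlt] at hne

/-- The semigroup ring `k[[S]]`: the ring of the formal power series all of whose exponents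
lie in `S`. -/
def SemigroupRing (k : Type*) [Field k] (S : AddSubmonoid ℕ) : Type _ :=
  ↥(powerSeriesWithExponentsIn k S)

noncomputable instance (k : Type*) [Field k] (S : AddSubmonoid ℕ) :
    CommRing (SemigroupRing k S) :=
  inferInstanceAs (CommRing ↥(powerSeriesWithExponentsIn k S))

noncomputable instance (k : Type*) [Field k] (S : AddSubmonoid ℕ) :
    Algebra k (SemigroupRing k S) :=
  inferInstanceAs (Algebra k ↥(powerSeriesWithExponentsIn k S))

/-- The inclusion of `k[[S]]` into `k[[t]]`. -/
noncomputable def SemigroupRing.val (k : Type*) [Field k] (S : AddSubmonoid ℕ) :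
    SemigroupRing k S →ₐ[k] k⟦X⟧ :=
  (powerSeriesWithExponentsIn k S).val

theorem SemigroupRing.isUnit {k : Type*} [Field k] {S : AddSubmonoid ℕ} (f : SemigroupRing k S)
    (h : PowerSeries.constantCoeff (SemigroupRing.val k S f) ≠ 0) : IsUnit f :=
  IsUnit.of_mul_eq_one
    (⟨(SemigroupRing.val k S f)⁻¹, inv_mem_powerSeriesWithExponentsIn f.2⟩ : SemigroupRing k S)
    (Subtype.ext (PowerSeries.mul_inv_cancel _ h))

instance SemigroupRing.nontrivial (k : Type*) [Field k] (S : AddSubmonoid ℕ) :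
    Nontrivial (SemigroupRing k S) :=
  (SemigroupRing.val k S).toRingHom.domain_nontrivial

instance SemigroupRing.isLocalRing (k : Type*) [Field k] (S : AddSubmonoid ℕ) :
    IsLocalRing (SemigroupRing k S) :=
  IsLocalRing.of_isUnit_or_isUnit_one_sub_self fun f => by
    by_cases h : PowerSeries.constantCoeff (SemigroupRing.val k S f) = 0
    · exact Or.inr (SemigroupRing.isUnit _ (by simp [h]))
    · exact Or.inl (SemigroupRing.isUnit _ h)

/-- The graded piece `𝔪ⁿ / 𝔪ⁿ⁺¹` of the tangent cone `G_𝔪 = ⨁ₙ 𝔪ⁿ / 𝔪ⁿ⁺¹` of a local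
ring `R` with maximal ideal `𝔪`. -/
def TangentConePiece (R : Type*) [CommRing R] [IsLocalRing R] (n : ℕ) : Type _ :=
  ↥(IsLocalRing.maximalIdeal R ^ n) ⧸
    Submodule.comap (Submodule.subtype (IsLocalRing.maximalIdeal R ^ n))
      (IsLocalRing.maximalIdeal R ^ (n + 1))

noncomputable instance (R : Type*) [CommRing R] [IsLocalRing R] (n : ℕ) :
    AddCommGroup (TangentConePiece R n) :=
  inferInstanceAs (AddCommGroup (↥(IsLocalRing.maximalIdeal R ^ n) ⧸
    Submodule.comap (Submodule.subtype (IsLocalRing.maximalIdeal R ^ n))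
      (IsLocalRing.maximalIdeal R ^ (n + 1))))

noncomputable instance (k R : Type*) [CommRing k] [CommRing R] [Algebra k R] [IsLocalRing R]
    (n : ℕ) : Module k (TangentConePiece R n) :=
  inferInstanceAs (Module k (↥(IsLocalRing.maximalIdeal R ^ n) ⧸
    Submodule.comap (Submodule.subtype (IsLocalRing.maximalIdeal R ^ n))
      (IsLocalRing.maximalIdeal R ^ (n + 1))))

/-- The Hilbert series `∑ₙ dim_k (Vₙ) xⁿ` of a graded `k`-vector space `⨁ₙ Vₙ`
(with finite-dimensional pieces). -/
noncomputable def hilbertSeries (k : Type*) [Field k] (V : ℕ → Type*)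
    [∀ n, AddCommGroup (V n)] [∀ n, Module k (V n)] : ℤ⟦X⟧ :=
  PowerSeries.mk fun n => (Module.finrank k (V n) : ℤ)

end TangentConeGamma5

namespace TangentConeGamma5

/-! A sum of generators with multiplicities `m, p, q, r, s` equals `W a + B d`, where `W = m + 2p +
3q + 4r + 5s` and `B = p + 3q + 6r + 10s`. Its length is `W` minus the excess `p + 2q + 3r + 4s`.
Small elements need small `W` and long expressions need small excess: two coin problems with coins
1, 3, 6, 10. One choice of coins solves both (`exists_counts`), and since `a ≥ 11`, reducing `B`
modulo `a` is never harmful. Hence each element of `Γ₅` is uniquely `w_b + m a` with `b < a`, where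
`w_b` is an Apéry element, and its order is `aperyOrder b + m` (`order_aperyElt_add`).

The power `𝔪ⁿ` consists of the series whose exponents have order at least `n`
(`maximalIdeal_pow_eq_orderIdeal`), so `dim 𝔪ⁿ/𝔪ⁿ⁺¹` counts elements of order `n`, one for each `b`
with `aperyOrder b ≤ n`. Multiplying by `1 - x` takes differences, which leaves `t_n`. The table
follows by induction on `a`. -/

/-! ### Two coin problems with coins 1, 3, 6, 10 -/

/-- The least value of `c₂ + 2 c₃ + 3 c₄ + 4 c₅` subject to `c₂ + 3 c₃ + 6 c₄ + 10 c₅ = b`. -/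
def minExcess (b : ℕ) : ℕ :=
  4 * (b / 10) + 3 * (b % 10 / 6) + 2 * (b % 10 % 6 / 3) + b % 10 % 6 % 3

/-- The order of the Apéry element of `Γ₅` that is congruent to `b d` modulo `a`, for `b < a`. -/
def aperyOrder (b : ℕ) : ℕ :=
  if b < 10 then b / 6 + b % 6 / 3 + b % 6 % 3
  else b / 10 + b % 10 / 6 + b % 10 % 6 / 3 + b % 10 % 6 % 3 - b % 10 % 6 % 3 / 2

/-- The least value of `2 c₂ + 3 c₃ + 4 c₄ + 5 c₅` subject to `c₂ + 3 c₃ + 6 c₄ + 10 c₅ = b`. -/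
def minWeight (b : ℕ) : ℕ := aperyOrder b + minExcess b

theorem minExcess_add_ten (b : ℕ) : minExcess (b + 10) = minExcess b + 4 := by
  simp only [minExcess, Nat.add_mod_right, Nat.add_div_right b (show 0 < 10 by norm_num)]
  ring

theorem aperyOrder_add_ten {b : ℕ} (hb : 10 ≤ b) : aperyOrder (b + 10) = aperyOrder b + 1 := by
  rw [aperyOrder, aperyOrder, if_neg (by omega), if_neg (by omega), Nat.add_mod_right,
    Nat.add_div_right b (show 0 < 10 by norm_num)]
  have := Nat.div_le_self (b % 10 % 6 % 3) 2
  omega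

theorem minWeight_add_ten {b : ℕ} (hb : 10 ≤ b) : minWeight (b + 10) = minWeight b + 5 := by
  rw [minWeight, minWeight, minExcess_add_ten, aperyOrder_add_ten hb]
  ring

/-- Induction with step ten from the numbers below twenty. -/
theorem induction_add_ten {P : ℕ → Prop} (h : ∀ b < 20, P b)
    (ih : ∀ b, 10 ≤ b → P b → P (b + 10)) (b : ℕ) : P b := by
  induction b using Nat.strong_induction_on with
  | _ b hb =>
    by_cases h20 : b < 20
    · exact h b h20
    · obtain ⟨c, rfl⟩ := Nat.exists_eq_add_of_le' (show 10 ≤ b by omega)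
      exact ih c (by omega) (hb c (by omega))

theorem minExcess_add_le (b : ℕ) :
    minExcess (b + 1) ≤ minExcess b + 1 ∧ minExcess (b + 3) ≤ minExcess b + 2 ∧
      minExcess (b + 6) ≤ minExcess b + 3 ∧ minExcess (b + 10) ≤ minExcess b + 4 := by
  induction b using induction_add_ten with
  | h => decide +revert
  | ih b hb ih =>
    simp only [add_right_comm b 10, minExcess_add_ten] at ih ⊢
    omega

theorem minWeight_add_le (b : ℕ) :
    minWeight (b + 1) ≤ minWeight b + 2 ∧ minWeight (b + 3) ≤ minWeight b + 3 ∧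
      minWeight (b + 6) ≤ minWeight b + 4 ∧ minWeight (b + 10) ≤ minWeight b + 5 := by
  induction b using induction_add_ten with
  | h => decide +revert
  | ih b hb ih =>
    rw [add_right_comm b 10 1, add_right_comm b 10 3, add_right_comm b 10 6,
      minWeight_add_ten hb, minWeight_add_ten (b := b + 10) (by omega),
      minWeight_add_ten (b := b + 1) (by omega), minWeight_add_ten (b := b + 3) (by omega),
      minWeight_add_ten (b := b + 6) (by omega), minWeight_add_ten hb]
    omega

theorem minExcess_bounds (b : ℕ) : 2 * b ≤ 5 * minExcess b ∧ 5 * minExcess b ≤ 2 * b + 10 := by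
  induction b using induction_add_ten with
  | h => decide +revert
  | ih b hb ih =>
    rw [minExcess_add_ten]
    omega

theorem minWeight_bounds (b : ℕ) : b ≤ 2 * minWeight b ∧ 2 * minWeight b ≤ b + 9 := by
  induction b using induction_add_ten with
  | h => decide +revert
  | ih b hb ih =>
    rw [minWeight_add_ten hb]
    omega

/-- Adding coins one at a time turns the one-coin inequalities into a lower bound for the cost of
every choice of coins. -/
theorem le_of_add_le {f : ℕ → ℕ} {w₁ w₃ w₆ w₁₀ : ℕ} (h0 : f 0 = 0)
    (h : ∀ b, f (b + 1) ≤ f b + w₁ ∧ f (b + 3) ≤ f b + w₃ ∧ f (b + 6) ≤ f b + w₆ ∧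
      f (b + 10) ≤ f b + w₁₀) (p q r s : ℕ) :
    f (p + 3 * q + 6 * r + 10 * s) ≤ p * w₁ + q * w₃ + r * w₆ + s * w₁₀ := by
  induction p with
  | succ p ih => grind
  | zero =>
    induction q with
    | succ q ih => grind
    | zero =>
      induction r with
      | succ r ih => grind
      | zero =>
        induction s with
        | succ s ih => grind
        | zero => simp [h0]

theorem minExcess_le_add {b n : ℕ} (hn : 10 ≤ n) : minExcess b ≤ minExcess (b + n) := by
  have := minExcess_bounds b
  have := minExcess_bounds (b + n)
  omega

theorem minWeight_le_add {b n : ℕ} (hn : 10 ≤ n) : minWeight b ≤ minWeight (b + n) + 1 := by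
  have := minWeight_bounds b
  have := minWeight_bounds (b + n)
  omega

/-- Greedy coins work, except that `10 + 1 + 1` is traded for `6 + 6`: this has the same excess but
weight 8 instead of 9. Below 10 there is no ten to trade, which is why `aperyOrder` is irregular
there. -/
theorem exists_counts (b : ℕ) : ∃ p q r s, p + 3 * q + 6 * r + 10 * s = b ∧
    p + q + r + s = aperyOrder b ∧ 2 * p + 3 * q + 4 * r + 5 * s = minWeight b := by
  induction b using induction_add_ten with
  | h b hb =>
    have : ∀ b < 20, ∃ p < 3, ∃ q < 2, ∃ r < 4, ∃ s < 2, p + 3 * q + 6 * r + 10 * s = b ∧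
        p + q + r + s = aperyOrder b ∧ 2 * p + 3 * q + 4 * r + 5 * s = minWeight b := by
      decide
    obtain ⟨p, -, q, -, r, -, s, -, h⟩ := this b hb
    exact ⟨p, q, r, s, h⟩
  | ih b hb ih =>
    obtain ⟨p, q, r, s, h⟩ := ih
    refine ⟨p, q, r, s + 1, ?_⟩
    rw [aperyOrder_add_ten hb, minWeight_add_ten hb]
    omega

/-! ### Sums of generators, orders and the Apéry set -/

/-- `x` is a sum of `n` of the generators `s₁, …, s₅`. -/
def IsSumOfGens (a d n x : ℕ) : Prop :=
  ∃ c : Fin 5 → ℕ, ∑ i, c i * gen a d (i + 1) = x ∧ ∑ i, c i = n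

theorem isSumOfGens_iff {a d n x : ℕ} : IsSumOfGens a d n x ↔ ∃ m p q r s,
    (m + 2 * p + 3 * q + 4 * r + 5 * s) * a + (p + 3 * q + 6 * r + 10 * s) * d = x ∧
      m + p + q + r + s = n := by
  obtain ⟨h1, h2, h3, h4, h5⟩ := gen_eq a d
  constructor
  · rintro ⟨c, hx, hn⟩
    refine ⟨c 0, c 1, c 2, c 3, c 4, ?_, ?_⟩
    · rw [← hx, Fin.sum_univ_five]
      simp [h1, h2, h3, h4, h5]
      ring
    · rw [← hn, Fin.sum_univ_five]
  · rintro ⟨m, p, q, r, s, hx, hn⟩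
    refine ⟨![m, p, q, r, s], ?_, ?_⟩
    · rw [← hx, Fin.sum_univ_five]
      simp [h1, h2, h3, h4, h5]
      ring
    · rw [← hn, Fin.sum_univ_five]
      simp

theorem IsSumOfGens.zero (a d : ℕ) : IsSumOfGens a d 0 0 := ⟨0, by simp, by simp⟩

theorem IsSumOfGens.add {a d n m x y : ℕ} (hx : IsSumOfGens a d n x) (hy : IsSumOfGens a d m y) :
    IsSumOfGens a d (n + m) (x + y) := by
  obtain ⟨c, rfl, rfl⟩ := hx
  obtain ⟨e, rfl, rfl⟩ := hy
  exact ⟨c + e, by simp [add_mul, Finset.sum_add_distrib], by simp [Finset.sum_add_distrib]⟩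

theorem isSumOfGens_gen (a d : ℕ) (i : Fin 5) : IsSumOfGens a d 1 (gen a d (i + 1)) :=
  ⟨Pi.single i 1, by simp [Pi.single_apply], by simp⟩

theorem IsSumOfGens.exists_sub_gen {a d n x : ℕ} (hx : IsSumOfGens a d (n + 1) x) :
    ∃ (i : Fin 5) (z : ℕ), IsSumOfGens a d n z ∧ x = z + gen a d (i + 1) := by
  obtain ⟨c, rfl, hn⟩ := hx
  obtain ⟨i, -, hi⟩ := Finset.exists_ne_zero_of_sum_ne_zero (hn.trans_ne n.succ_ne_zero)
  have hc : c = (c - Pi.single i 1) + Pi.single i 1 := by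
    refine (tsub_add_cancel_of_le fun j => ?_).symm
    by_cases h : j = i
    · subst h
      simpa using Nat.one_le_iff_ne_zero.2 hi
    · simp [h]
  generalize c - Pi.single i 1 = e at hc
  subst hc
  refine ⟨i, ∑ j, e j * gen a d (j + 1), ⟨e, rfl, ?_⟩, ?_⟩
  · simpa [Finset.sum_add_distrib] using hn
  · simp [add_mul, Finset.sum_add_distrib, Pi.single_apply]

theorem mem_Gamma5_iff {a d x : ℕ} : x ∈ Gamma5 a d ↔ ∃ n, IsSumOfGens a d n x := by
  constructor
  · intro hx
    refine AddSubmonoid.closure_induction ?_ ⟨0, .zero a d⟩ ?_ hx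
    · rintro _ ⟨i, rfl⟩
      exact ⟨1, isSumOfGens_gen a d i⟩
    · rintro _ _ _ _ ⟨n, hn⟩ ⟨m, hm⟩
      exact ⟨n + m, hn.add hm⟩
  · rintro ⟨n, c, rfl, -⟩
    refine sum_mem fun i _ => ?_
    have hi : gen a d (i + 1) ∈ Gamma5 a d := AddSubmonoid.subset_closure ⟨i, rfl⟩
    exact nsmul_mem hi (c i)

/-- The Apéry element of `Γ₅` that is congruent to `b d` modulo `a`, for `b < a`. -/
def aperyElt (a d b : ℕ) : ℕ := minWeight b * a + b * d

theorem isSumOfGens_aperyElt_add (a d b m : ℕ) :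
    IsSumOfGens a d (aperyOrder b + m) (aperyElt a d b + m * a) := by
  obtain ⟨p, q, r, s, h1, h2, h3⟩ := exists_counts b
  refine isSumOfGens_iff.2 ⟨m, p, q, r, s, ?_, by omega⟩
  rw [aperyElt, h1, ← h3]
  ring

/-- Reducing `B` to `B % a` trades `a k d` for `k d` further copies of `a`. It remains to see that
neither minimum grows by more than `k d`; the excess then bounds the length and the weight gives `m
≥ 0`. -/
theorem IsSumOfGens.exists_eq_aperyElt_add {a d n x : ℕ} (ha : 11 ≤ a) (hd : 0 < d)
    (h : IsSumOfGens a d n x) :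
    ∃ b < a, ∃ m, x = aperyElt a d b + m * a ∧ n ≤ aperyOrder b + m := by
  obtain ⟨m, p, q, r, s, rfl, rfl⟩ := isSumOfGens_iff.1 h
  have he := le_of_add_le (f := minExcess) rfl minExcess_add_le p q r s
  have hw := le_of_add_le (f := minWeight) rfl minWeight_add_le p q r s
  generalize hB : p + 3 * q + 6 * r + 10 * s = B at he hw ⊢
  set k := B / a with hk
  have hBk : B % a + a * k = B := Nat.mod_add_div B a
  have key : minExcess (B % a) ≤ minExcess B + k * d ∧
      minWeight (B % a) ≤ minWeight B + k * d := by
    rcases Nat.eq_zero_or_pos k with h0 | hpos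
    · rw [h0, mul_zero, add_zero] at hBk
      simp [hBk]
    -- A drop of at least 10 raises the minimal weight by at most 1, and this is absorbed by `k * d
    -- ≥ 1`.
    · have h10 : 10 ≤ a * k := by nlinarith
      have h1 : 1 ≤ k * d := Nat.mul_pos hpos hd
      have h2 := minExcess_le_add (b := B % a) h10
      have h3 := minWeight_le_add (b := B % a) h10
      rw [hBk] at h2 h3
      omega
  have hdef : minWeight (B % a) = aperyOrder (B % a) + minExcess (B % a) := rfl
  obtain ⟨l, hl⟩ := Nat.exists_eq_add_of_le
    (show minWeight (B % a) ≤ m + 2 * p + 3 * q + 4 * r + 5 * s + k * d by omega)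
  refine ⟨B % a, Nat.mod_lt _ (by omega), l, ?_, by omega⟩
  calc (m + 2 * p + 3 * q + 4 * r + 5 * s) * a + B * d
      = (m + 2 * p + 3 * q + 4 * r + 5 * s) * a + (B % a + a * k) * d := by rw [hBk]
    _ = (m + 2 * p + 3 * q + 4 * r + 5 * s + k * d) * a + B % a * d := by ring
    _ = aperyElt a d (B % a) + l * a := by rw [hl, aperyElt]; ring

theorem aperyElt_add_inj {a d b b' m m' : ℕ} (had : Nat.Coprime a d) (hb : b < a) (hb' : b' < a)
    (h : aperyElt a d b + m * a = aperyElt a d b' + m' * a) : b = b' ∧ m = m' := by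
  have hbb : b = b' := by
    have hmod : b * d ≡ b' * d [MOD a] := by
      have h1 : (aperyElt a d b + m * a) % a = (aperyElt a d b' + m' * a) % a := by rw [h]
      simpa [aperyElt, Nat.ModEq] using h1
    have := Nat.ModEq.cancel_right_of_coprime had hmod
    rwa [Nat.ModEq, Nat.mod_eq_of_lt hb, Nat.mod_eq_of_lt hb'] at this
  subst hbb
  exact ⟨rfl, Nat.eq_of_mul_eq_mul_right (by omega) (Nat.add_left_cancel h)⟩

/-- Each added `a` raises the order by exactly one, so Apéry elements alone determine all orders. -/
theorem order_aperyElt_add {a d b : ℕ} (ha : 11 ≤ a) (hd : 0 < d) (had : Nat.Coprime a d)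
    (hb : b < a) (m : ℕ) : order a d (aperyElt a d b + m * a) = aperyOrder b + m := by
  refine IsGreatest.csSup_eq ⟨isSumOfGens_aperyElt_add a d b m, fun n hn => ?_⟩
  obtain ⟨b', hb', m', h, hle⟩ := IsSumOfGens.exists_eq_aperyElt_add ha hd hn
  obtain ⟨rfl, rfl⟩ := aperyElt_add_inj had hb hb' h
  exact hle

theorem mem_aperySet_Gamma5_iff {a d x : ℕ} (ha : 11 ≤ a) (hd : 0 < d) (had : Nat.Coprime a d) :
    x ∈ aperySet (Gamma5 a d) a ↔ ∃ b < a, x = aperyElt a d b := by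
  constructor
  · rintro ⟨hx, hxa⟩
    obtain ⟨n, hn⟩ := mem_Gamma5_iff.1 hx
    obtain ⟨b, hb, m, rfl, -⟩ := hn.exists_eq_aperyElt_add ha hd
    refine ⟨b, hb, ?_⟩
    cases m with
    | zero => simp
    | succ m =>
      exact absurd ⟨_, mem_Gamma5_iff.2 ⟨_, isSumOfGens_aperyElt_add a d b m⟩, by ring⟩ hxa
  · rintro ⟨b, hb, rfl⟩
    refine ⟨mem_Gamma5_iff.2 ⟨_, by simpa using isSumOfGens_aperyElt_add a d b 0⟩, ?_⟩
    rintro ⟨y, hy, h⟩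
    obtain ⟨n, hn⟩ := mem_Gamma5_iff.1 hy
    obtain ⟨b', hb', m, rfl, -⟩ := hn.exists_eq_aperyElt_add ha hd
    have := (aperyElt_add_inj (m := 0) (m' := m + 1) had hb hb' (by linarith)).2
    omega

theorem t_eq_card {a d : ℕ} (ha : 11 ≤ a) (hd : 0 < d) (had : Nat.Coprime a d) (j : ℕ) :
    t a d j = {b ∈ Finset.range a | aperyOrder b = j}.card := by
  have hord : ∀ b < a, order a d (aperyElt a d b) = aperyOrder b := fun b hb => by
    simpa using order_aperyElt_add ha hd had hb 0
  have himage : {x | x ∈ aperySet (Gamma5 a d) a ∧ order a d x = j} =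
      aperyElt a d '' ({b ∈ Finset.range a | aperyOrder b = j} : Finset ℕ) := by
    ext x
    simp only [Set.mem_ofPred_eq, mem_aperySet_Gamma5_iff ha hd had, Set.mem_image,
      Finset.mem_coe, Finset.mem_filter, Finset.mem_range]
    constructor
    · rintro ⟨⟨b, hb, rfl⟩, h⟩
      exact ⟨b, ⟨hb, hord b hb ▸ h⟩, rfl⟩
    · rintro ⟨b, ⟨hb, h⟩, rfl⟩
      exact ⟨⟨b, hb, rfl⟩, (hord b hb).trans h⟩
  rw [t, himage, Set.InjOn.ncard_image, Set.ncard_coe_finset]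
  intro b hb b' hb' h
  simp only [Finset.mem_coe, Finset.mem_filter, Finset.mem_range] at hb hb'
  exact (aperyElt_add_inj (m := 0) (m' := 0) had hb.1 hb'.1 (by simpa using h)).1

/-! ### Counting Apéry elements by order -/

/-- Passing from `a` to `a + 1` admits the single new residue `b = a`. The correction `psi` comes
from the irregular orders below 10, so it is untouched here. -/
theorem tTable_succ {a : ℕ} (ha : 11 ≤ a) (j : ℕ) :
    tTable (a + 1) j = tTable a j + if aperyOrder a = j then 1 else 0 := by
  have ho : aperyOrder a = a / 10 + a % 10 / 6 + a % 10 % 6 / 3 + a % 10 % 6 % 3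
      - a % 10 % 6 % 3 / 2 := if_neg (by omega)
  rw [ho]
  -- When `r = 9`, the entry at `q + 3` changes from the default 0 to one containing `psi`; as `q ≥
  -- 1`, vanishing of `psi` from 4 on suffices.
  unfold tTable
  have hpsi : 4 ≤ j → psi j = 0 := fun hj => by
    rw [psi, if_neg (by omega), if_neg (by omega)]
  generalize psi j = ψ at hpsi ⊢
  dsimp only
  obtain ⟨q, r, hr, hqr, rfl⟩ : ∃ q r, r < 10 ∧ 11 ≤ 10 * q + r ∧ a = 10 * q + r :=
    ⟨a / 10, a % 10, by omega, by omega, by omega⟩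
  have hq : (10 * q + r) / 10 = q := by omega
  have hm : (10 * q + r) % 10 = r := by omega
  rw [hq, hm]
  by_cases h9 : r = 9
  · subst h9
    have hq' : (10 * q + 9 + 1) / 10 = q + 1 := by omega
    have hm' : (10 * q + 9 + 1) % 10 = 0 := by omega
    rw [hq', hm']
    clear ho hq hm hq' hm' hr ha
    simp only [Nat.reduceDiv, Nat.reduceMod, Nat.reduceLeDiff, Nat.reduceEqDiff, if_true, if_false,
      OfNat.ofNat_ne_zero, add_zero, tsub_zero]
    split_ifs <;> omega
  · have hq' : (10 * q + r + 1) / 10 = q := by omega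
    have hm' : (10 * q + r + 1) % 10 = r + 1 := by omega
    have hr9 : r < 9 := by omega
    rw [hq', hm']
    clear ho hq hm hq' hm' ha hr h9
    interval_cases r <;> simp only [Nat.reduceDiv, Nat.reduceMod, Nat.reduceAdd, Nat.reduceLeDiff,
      Nat.reduceEqDiff, if_true, if_false, OfNat.ofNat_ne_zero, add_zero, tsub_zero] <;>
      split_ifs <;> omega

theorem card_filter_aperyOrder {a : ℕ} (ha : 11 ≤ a) (j : ℕ) :
    (({b ∈ Finset.range a | aperyOrder b = j}.card : ℕ) : ℤ) = tTable a j := by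
  induction a, ha using Nat.le_induction with
  | base =>
    by_cases hj : j < 4
    · interval_cases j <;> decide
    · rw [Finset.filter_false_of_mem]
      · simp [tTable]
        split_ifs <;> omega
      · intro b hb
        have : ∀ b ∈ Finset.range 11, aperyOrder b < 4 := by decide
        have := this b hb
        omega
  | succ a ha ih =>
    rw [tTable_succ ha, ← ih, Finset.range_add_one, Finset.filter_insert]
    split_ifs with h
    · rw [Finset.card_insert_of_notMem (by simp)]
      push_cast
      rfl
    · simp

/-! ### The order filtration on the semigroup -/

/-- `x` is a sum of at least `n` of the generators `s₁, …, s₅`. -/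
def OrderGE (a d n x : ℕ) : Prop := ∃ m, n ≤ m ∧ IsSumOfGens a d m x

theorem OrderGE.add {a d n m x y : ℕ} (hx : OrderGE a d n x) (hy : OrderGE a d m y) :
    OrderGE a d (n + m) (x + y) := by
  obtain ⟨i, hi, hx⟩ := hx
  obtain ⟨j, hj, hy⟩ := hy
  exact ⟨i + j, by omega, hx.add hy⟩

theorem OrderGE.mono {a d n m x : ℕ} (h : n ≤ m) (hx : OrderGE a d m x) : OrderGE a d n x := by
  obtain ⟨i, hi, hx⟩ := hx
  exact ⟨i, h.trans hi, hx⟩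

theorem orderGE_zero_iff {a d x : ℕ} : OrderGE a d 0 x ↔ x ∈ Gamma5 a d := by
  simp [OrderGE, mem_Gamma5_iff]

theorem orderGE_gen (a d : ℕ) (i : Fin 5) : OrderGE a d 1 (gen a d (i + 1)) :=
  ⟨1, le_rfl, isSumOfGens_gen a d i⟩

theorem OrderGE.exists_sub_gen {a d n x : ℕ} (hx : OrderGE a d (n + 1) x) :
    ∃ (i : Fin 5) (z : ℕ), OrderGE a d n z ∧ x = z + gen a d (i + 1) := by
  obtain ⟨_ | m, hm, hx⟩ := hx
  · omega
  · obtain ⟨i, z, hz, h⟩ := hx.exists_sub_gen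
    exact ⟨i, z, ⟨m, by omega, hz⟩, h⟩

theorem gen_pos {a d : ℕ} (ha : 0 < a) (i : Fin 5) : 0 < gen a d (i + 1) := by
  obtain ⟨h1, h2, h3, h4, h5⟩ := gen_eq a d
  fin_cases i <;> simp <;> omega

theorem orderGE_one_iff {a d x : ℕ} (ha : 0 < a) : OrderGE a d 1 x ↔ x ∈ Gamma5 a d ∧ x ≠ 0 := by
  constructor
  · intro h
    refine ⟨orderGE_zero_iff.1 (h.mono zero_le_one), ?_⟩
    obtain ⟨i, z, -, rfl⟩ := h.exists_sub_gen
    have := gen_pos (d := d) ha i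
    omega
  · rintro ⟨hx, h0⟩
    obtain ⟨_ | m, c, hx, hc⟩ := mem_Gamma5_iff.1 hx
    · refine absurd ?_ h0
      rw [Finset.sum_eq_zero_iff] at hc
      rw [← hx]
      exact Finset.sum_eq_zero fun i hi => by rw [hc i hi, zero_mul]
    · exact ⟨m + 1, by omega, c, hx, hc⟩

theorem orderGE_aperyElt_add_iff {a d b m n : ℕ} (ha : 11 ≤ a) (hd : 0 < d)
    (had : Nat.Coprime a d) (hb : b < a) :
    OrderGE a d n (aperyElt a d b + m * a) ↔ n ≤ aperyOrder b + m := by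
  constructor
  · rintro ⟨i, hi, h⟩
    obtain ⟨b', hb', m', h, hle⟩ := h.exists_eq_aperyElt_add ha hd
    obtain ⟨rfl, rfl⟩ := aperyElt_add_inj had hb hb' h
    exact hi.trans hle
  · exact fun h => ⟨_, h, isSumOfGens_aperyElt_add a d b m⟩

/-- The elements of `Γ₅` of order `n`. -/
def orderFiber (a d n : ℕ) : Finset ℕ :=
  {b ∈ Finset.range a | aperyOrder b ≤ n}.image
    fun b => aperyElt a d b + (n - aperyOrder b) * a

theorem mem_orderFiber_iff {a d n x : ℕ} (ha : 11 ≤ a) (hd : 0 < d) (had : Nat.Coprime a d) :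
    x ∈ orderFiber a d n ↔ OrderGE a d n x ∧ ¬ OrderGE a d (n + 1) x := by
  simp only [orderFiber, Finset.mem_image, Finset.mem_filter, Finset.mem_range]
  constructor
  · rintro ⟨b, ⟨hb, hn⟩, rfl⟩
    rw [orderGE_aperyElt_add_iff ha hd had hb, orderGE_aperyElt_add_iff ha hd had hb]
    omega
  · rintro ⟨h, h'⟩
    obtain ⟨i, -, hx⟩ := id h
    obtain ⟨b, hb, m, rfl, -⟩ := hx.exists_eq_aperyElt_add ha hd
    rw [orderGE_aperyElt_add_iff ha hd had hb] at h h'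
    exact ⟨b, ⟨hb, by omega⟩, by rw [show n - aperyOrder b = m by omega]⟩

theorem card_orderFiber {a d : ℕ} (had : Nat.Coprime a d) (n : ℕ) :
    (orderFiber a d n).card = {b ∈ Finset.range a | aperyOrder b ≤ n}.card := by
  refine Finset.card_image_of_injOn fun b hb b' hb' h => ?_
  simp only [Finset.coe_filter, Finset.mem_range, Set.mem_ofPred_eq] at hb hb'
  exact (aperyElt_add_inj had hb.1 hb'.1 h).1

/-! ### Powers of the maximal ideal and the tangent cone -/

section Ring

variable {k : Type*} [Field k] {a d : ℕ}

/-- The ideal of the power series in `k[[Γ₅]]` all of whose exponents have order at least `n`. -/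
def orderIdeal (k : Type*) [Field k] (a d n : ℕ) : Ideal (SemigroupRing k (Gamma5 a d)) where
  carrier := {f | ∀ x, PowerSeries.coeff x (SemigroupRing.val k _ f) ≠ 0 → OrderGE a d n x}
  add_mem' := by
    intro f g hf hg x hx
    rw [map_add, map_add] at hx
    by_cases h : PowerSeries.coeff x (SemigroupRing.val k _ f) = 0
    · exact hg x (by simpa [h] using hx)
    · exact hf x h
  zero_mem' := by
    intro x hx
    simp at hx
  smul_mem' := by
    intro f g hg x hx
    rw [smul_eq_mul, map_mul, PowerSeries.coeff_mul] at hx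
    obtain ⟨p, hp, hne⟩ := Finset.exists_ne_zero_of_sum_ne_zero hx
    rw [← Finset.HasAntidiagonal.mem_antidiagonal.1 hp, ← zero_add n]
    exact (orderGE_zero_iff.2 (f.2 _ (left_ne_zero_of_mul hne))).add
      (hg _ (right_ne_zero_of_mul hne))

theorem mem_orderIdeal_iff {n : ℕ} {f : SemigroupRing k (Gamma5 a d)} : f ∈ orderIdeal k a d n ↔
    ∀ x, PowerSeries.coeff x (SemigroupRing.val k _ f) ≠ 0 → OrderGE a d n x :=
  Iff.rfl

theorem orderIdeal_zero : orderIdeal k a d 0 = ⊤ :=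
  eq_top_iff.2 fun f _ x hx => orderGE_zero_iff.2 (f.2 x hx)

theorem maximalIdeal_eq_orderIdeal (ha : 0 < a) :
    IsLocalRing.maximalIdeal (SemigroupRing k (Gamma5 a d)) = orderIdeal k a d 1 := by
  symm
  refine IsLocalRing.eq_maximalIdeal (Ideal.isMaximal_iff.2 ⟨fun h => ?_, fun J f _ hf hfJ => ?_⟩)
  · exact ((orderGE_one_iff ha).1 (h 0 (by simp))).2 rfl
  · refine (Ideal.eq_top_iff_one J).1 (J.eq_top_of_isUnit_mem hfJ (SemigroupRing.isUnit f ?_))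
    contrapose! hf
    refine fun x hx => (orderGE_one_iff ha).2 ⟨f.2 x hx, ?_⟩
    rintro rfl
    exact hx (by simpa using hf)

theorem orderIdeal_mul_le (n m : ℕ) :
    orderIdeal k a d n * orderIdeal k a d m ≤ orderIdeal k a d (n + m) := by
  refine Ideal.mul_le.2 fun f hf g hg x hx => ?_
  rw [map_mul, PowerSeries.coeff_mul] at hx
  obtain ⟨p, hp, hne⟩ := Finset.exists_ne_zero_of_sum_ne_zero hx
  rw [← Finset.HasAntidiagonal.mem_antidiagonal.1 hp]
  exact (hf _ (left_ne_zero_of_mul hne)).add (hg _ (right_ne_zero_of_mul hne))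

/-- An element of `k[[Γ₅]]` given by its coefficients. -/
def ofCoeff (c : ℕ → k) (hc : ∀ x, c x ≠ 0 → x ∈ Gamma5 a d) : SemigroupRing k (Gamma5 a d) :=
  ⟨PowerSeries.mk c, fun x hx => hc x (by simpa using hx)⟩

@[simp]
theorem coeff_val_ofCoeff (c : ℕ → k) (hc : ∀ x, c x ≠ 0 → x ∈ Gamma5 a d) (x : ℕ) :
    PowerSeries.coeff x (SemigroupRing.val k _ (ofCoeff c hc)) = c x :=
  PowerSeries.coeff_mk x c

-- Choose for each exponent of order at least `n + 1` a generator whose removal leaves order at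
-- least `n`. Grouping the terms of `f` by this choice writes an infinite series as only five
-- products `t^{s_i} G_i`.
open Classical in
theorem orderIdeal_succ_le (n : ℕ) :
    orderIdeal k a d (n + 1) ≤ orderIdeal k a d 1 * orderIdeal k a d n := by
  intro f hf
  have hex : ∀ x : ℕ, ∃ i : Fin 5, OrderGE a d (n + 1) x →
      ∃ z, OrderGE a d n z ∧ x = z + gen a d (i + 1) := fun x => by
    by_cases hx : OrderGE a d (n + 1) x
    · obtain ⟨i, h⟩ := hx.exists_sub_gen
      exact ⟨i, fun _ => h⟩
    · exact ⟨0, fun h => absurd h hx⟩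
  choose ι hι using hex
  let F := SemigroupRing.val k _ f
  have hpart : ∀ (i : Fin 5) (z : ℕ), (if ι (z + gen a d (i + 1)) = i then
      PowerSeries.coeff (z + gen a d (i + 1)) F else 0) ≠ 0 → OrderGE a d n z := by
    intro i z hz
    split_ifs at hz with hi
    · obtain ⟨w, hw, h⟩ := hι _ (hf _ hz)
      rw [hi] at h
      rwa [Nat.add_right_cancel h]
    · exact absurd rfl hz
  let G : Fin 5 → SemigroupRing k (Gamma5 a d) := fun i => ofCoeff _ fun z hz =>
    orderGE_zero_iff.1 ((hpart i z hz).mono n.zero_le)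
  let T : Fin 5 → SemigroupRing k (Gamma5 a d) := fun i =>
    ⟨PowerSeries.X ^ gen a d (i + 1), fun x hx => by
      rw [PowerSeries.coeff_X_pow] at hx
      split_ifs at hx with h
      · exact h ▸ orderGE_zero_iff.1 ((orderGE_gen a d i).mono zero_le_one)
      · exact absurd rfl hx⟩
  have hval : ∀ i, SemigroupRing.val k _ (T i) = PowerSeries.X ^ gen a d (i + 1) := fun i => rfl
  have hsum : f = ∑ i, T i * G i := by
    refine Subtype.ext (PowerSeries.ext fun x => ?_)
    change PowerSeries.coeff x F = PowerSeries.coeff x (SemigroupRing.val k _ (∑ i, T i * G i))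
    simp only [map_sum, map_mul, hval, PowerSeries.coeff_X_pow_mul']
    rw [Finset.sum_eq_single_of_mem (ι x) (Finset.mem_univ _)]
    · by_cases hx : PowerSeries.coeff x F = 0
      · split_ifs with h
        · simp [G, Nat.sub_add_cancel h, hx]
        · exact hx
      · obtain ⟨z, -, h⟩ := hι x (hf x hx)
        have hle : gen a d (ι x + 1) ≤ x := by omega
        simp [G, hle, Nat.sub_add_cancel hle]
    · intro i _ hi
      split_ifs with h
      · simp [G, Nat.sub_add_cancel h, hi.symm]
      · rfl
  rw [hsum]
  refine sum_mem fun i _ => Ideal.mul_mem_mul (fun x hx => ?_) fun x hx => hpart i x ?_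
  · rw [hval, PowerSeries.coeff_X_pow] at hx
    split_ifs at hx with h
    · exact h ▸ orderGE_gen a d i
    · exact absurd rfl hx
  · simpa only [G, coeff_val_ofCoeff] using hx

theorem maximalIdeal_pow_eq_orderIdeal (ha : 0 < a) (n : ℕ) :
    IsLocalRing.maximalIdeal (SemigroupRing k (Gamma5 a d)) ^ n = orderIdeal k a d n := by
  induction n with
  | zero => rw [pow_zero, orderIdeal_zero, Ideal.one_eq_top]
  | succ n ih =>
    rw [pow_succ', ih, maximalIdeal_eq_orderIdeal ha]
    refine le_antisymm ?_ (orderIdeal_succ_le n)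
    rw [add_comm n 1]
    exact orderIdeal_mul_le 1 n

/-- The coefficients of a power series at the exponents in `D`. -/
noncomputable def coeffsAt (I : Ideal (SemigroupRing k (Gamma5 a d))) (D : Finset ℕ) :
    I →ₗ[k] (D → k) :=
  LinearMap.pi fun x => PowerSeries.coeff (x : ℕ) ∘ₗ (SemigroupRing.val k _).toLinearMap ∘ₗ
    (I.subtype.restrictScalars k)

theorem coeffsAt_apply (I : Ideal (SemigroupRing k (Gamma5 a d))) (D : Finset ℕ) (f : I) (x : D) :
    coeffsAt I D f x = PowerSeries.coeff (x : ℕ) (SemigroupRing.val k (Gamma5 a d) f) :=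
  rfl

/-- The `n`-th graded piece of the tangent cone of `k[[Γ₅]]` has the elements of order `n`
as a basis. -/
theorem nonempty_tangentConePiece_equiv (ha : 11 ≤ a) (hd : 0 < d) (had : Nat.Coprime a d)
    (n : ℕ) : Nonempty (TangentConePiece (SemigroupRing k (Gamma5 a d)) n ≃ₗ[k]
      (orderFiber a d n → k)) := by
  have hpow := maximalIdeal_pow_eq_orderIdeal (k := k) (d := d) (show 0 < a by omega)
  set I := IsLocalRing.maximalIdeal (SemigroupRing k (Gamma5 a d)) with hI
  set φ := coeffsAt (I ^ n) (orderFiber a d n) with hφ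
  -- A series in `𝔪ⁿ` lies in `𝔪ⁿ⁺¹` exactly when its coefficients at exponents of order `n` vanish.
  have hker : LinearMap.ker φ =
      (Submodule.comap (Submodule.subtype (I ^ n)) (I ^ (n + 1))).restrictScalars k := by
    ext ⟨f, hf⟩
    simp only [LinearMap.mem_ker, Submodule.restrictScalars_mem, Submodule.mem_comap,
      Submodule.subtype_apply]
    rw [hpow] at hf
    rw [hpow (n + 1), mem_orderIdeal_iff, funext_iff]
    constructor
    · intro h x hx
      by_contra hlt
      exact hx (h ⟨x, (mem_orderFiber_iff ha hd had).2 ⟨hf x hx, hlt⟩⟩)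
    · rintro h ⟨x, hx⟩
      by_contra hne
      exact ((mem_orderFiber_iff ha hd had).1 hx).2 (h x hne)
  have hsurj : Function.Surjective φ := by
    intro c
    have hc : ∀ x, (if h : x ∈ orderFiber a d n then c ⟨x, h⟩ else 0) ≠ 0 → OrderGE a d n x := by
      intro x hx
      split_ifs at hx with h
      · exact ((mem_orderFiber_iff ha hd had).1 h).1
      · exact absurd rfl hx
    refine ⟨⟨ofCoeff _ fun x hx => orderGE_zero_iff.1 ((hc x hx).mono n.zero_le), ?_⟩, ?_⟩
    · rw [hpow]
      exact fun x hx => hc x (by simpa only [coeff_val_ofCoeff] using hx)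
    · ext ⟨x, hx⟩
      rw [hφ, coeffsAt_apply, coeff_val_ofCoeff, dif_pos hx]
  exact ⟨(Submodule.Quotient.restrictScalarsEquiv k _).symm ≪≫ₗ
    Submodule.quotEquivOfEq _ _ hker.symm ≪≫ₗ φ.quotKerEquivOfSurjective hsurj⟩

end Ring

/-! ### The Hilbert series -/

theorem card_filter_le_succ (f : ℕ → ℕ) (s : Finset ℕ) (n : ℕ) :
    {b ∈ s | f b ≤ n + 1}.card = {b ∈ s | f b ≤ n}.card + {b ∈ s | f b = n + 1}.card := by
  rw [← Finset.card_union_of_disjoint, ← Finset.filter_or]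
  · simp only [Nat.le_succ_iff]
  · exact Finset.disjoint_filter.2 fun b _ h h' => by omega

end TangentConeGamma5

open TangentConeGamma5 in
theorem mainTheorem11 (k : Type*) [Field k] (a d : ℕ) (ha : 11 ≤ a) (hd : 0 < d)
    (had : Nat.Coprime a d) :
    (∀ n, Module.Finite k (TangentConePiece (SemigroupRing k (Gamma5 a d)) n)) ∧
    (∀ j, (t a d j : ℤ) = tTable a j) ∧
    hilbertSeries k (TangentConePiece (SemigroupRing k (Gamma5 a d))) * (1 - PowerSeries.X) =
      ∑ j ∈ Finset.range (a / 10 + 3), PowerSeries.C (t a d j : ℤ) * PowerSeries.X ^ j := by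
  have ht : ∀ j, (t a d j : ℤ) = tTable a j := fun j => by
    rw [t_eq_card ha hd had, card_filter_aperyOrder ha]
  refine ⟨fun n => ?_, ht, ?_⟩
  · obtain ⟨e⟩ := nonempty_tangentConePiece_equiv (k := k) ha hd had n
    exact Module.Finite.equiv e.symm
  have hrank : ∀ n, Module.finrank k (TangentConePiece (SemigroupRing k (Gamma5 a d)) n) =
      {b ∈ Finset.range a | aperyOrder b ≤ n}.card := fun n => by
    obtain ⟨e⟩ := nonempty_tangentConePiece_equiv (k := k) ha hd had n
    rw [e.finrank_eq, Module.finrank_fintype_fun_eq_card, Fintype.card_coe, card_orderFiber had]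
  have hcoeff : ∀ n, PowerSeries.coeff n (hilbertSeries k
      (TangentConePiece (SemigroupRing k (Gamma5 a d))) * (1 - PowerSeries.X)) = (t a d n : ℤ) := by
    rintro (_ | n)
    · simp [hilbertSeries, hrank, t_eq_card ha hd had]
    · rw [mul_sub, mul_one, map_sub, PowerSeries.coeff_succ_mul_X, hilbertSeries,
        PowerSeries.coeff_mk, PowerSeries.coeff_mk, hrank, hrank, t_eq_card ha hd had,
        card_filter_le_succ]
      push_cast
      ring
  ext n
  rw [hcoeff]
  simp only [map_sum, PowerSeries.coeff_C_mul, PowerSeries.coeff_X_pow, mul_ite, mul_one, mul_zero]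
  rw [Finset.sum_ite_eq]
  split_ifs with hn
  · rfl
  -- Beyond degree `a / 10 + 2` the table is zero, so the truncated sum misses nothing.
  · rw [Finset.mem_range] at hn
    rw [ht, tTable, if_neg (by omega), if_neg (by omega), if_neg (by omega), if_neg (by omega),
      if_neg (by omega), if_neg (by omega)]
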